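/- For a finite set $\mathcal P$ of points of $\mathbb R^2$ with distinct $x$-coordinates and distinct $y$-coordinates, let $\mathcal T\langle\mathcal P\rangle$ be the binary search tree obtained by inserting the $y$-coordinates of the points, in increasing order of the $x$-coordinates, one after the other into the initially empty tree, and let $h(\mathcal P)$ be its height, i.e. the maximal number of edges on a path from the root to a node. For a probability measure $\mu$ on $\mathbb R^2$, let $\mathcal P^n_\mu$ be a set of $n$ independent points with distribution $\mu$. Let $c^*$ be the unique solution $c\ge 2$ of $c\log(2e/c)=1$. For $0<\beta\le 1$, let $\mu_\beta$ be the measure consisting of a mass $\beta$ uniformly distributed on the band $[0,\beta]\times[0,1]$ and a mass $1-\beta$ uniformly distributed on the line segment from $(\beta,0)$ to $(1,1)$. **Proposition 5.2.** (i) For every $0<\beta\le1$, the measure $\mu_\beta$ is a permuton (a measure on $[0,1]^2$ whose two marginals are the uniform measure on $[0,1]$) which has density $1$ on the band $[0,\beta]\times[0,1]$, and for every $\varepsilon>0$, $$\lim_{n\to\infty}\mathbb P\left[h\big(\mathcal P^n_{\mu_\beta}\big)\ \ge\ \frac{1-\beta}{\beta+\varepsilon}\,\log n\right]=1 .$$ (ii)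 Hence a positive density on a band alone does not give the $c^*\log n$ asymptotics: for every $\beta$ with $0<\beta<\frac1{1+c^*}$ (equivalently, $\frac{1-\beta}{\beta}>c^*$), the ratio $h\big(\mathcal P^n_{\mu_\beta}\big)/(c^*\log n)$ does not converge to $1$ in probability as $n\to\infty$. -/

import Mathlib

open MeasureTheory Set Filter Topology

noncomputable section

/-- Insertion of a new label `x` into a binary search tree: go to the left subtree when `x` is
smaller than the label of the current node, to the right subtree otherwise, and create a new node
when an empty subtree is reached. -/
def bstInsert {α : Type*} [LinearOrder α] (x : α) : BinaryTree α → BinaryTree α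
  | .nil => .node x .nil .nil
  | .node v l r => if x < v then .node v (bstInsert x l) r else .node v l (bstInsert x r)

/-- The binary search tree of a sequence: its terms are inserted one after the other,
starting from the empty tree. -/
def bstOfList {α : Type*} [LinearOrder α] (ys : List α) : BinaryTree α :=
  ys.foldl (fun t y => bstInsert y t) .nil

/-- The height of a tree: the maximal graph distance (number of edges) from the root to a node.
Mathlib's `BinaryTree.height` counts the nodes on the path; the empty tree gets `0`. -/
def edgeHeight {α : Type*} (t : BinaryTree α) : ℕ := t.height - 1

/-- The `y`-coordinates of `n` points of the plane, listed in increasing order of the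
`x`-coordinates of the points. -/
def ySequence {n : ℕ} (P : Fin n → ℝ × ℝ) : List ℝ :=
  List.ofFn fun i => (P (Tuple.sort (fun j => (P j).1) i)).2

/-- The binary search tree of `n` points of the plane (with distinct `x`-coordinates and distinct
`y`-coordinates; the other configurations are negligible below). -/
def bstOfPoints {n : ℕ} (P : Fin n → ℝ × ℝ) : BinaryTree ℝ := bstOfList (ySequence P)

/-- The height of the binary search tree of `n` points of the plane. -/
def bstHeight {n : ℕ} (P : Fin n → ℝ × ℝ) : ℕ := edgeHeight (bstOfPoints P)

/-- A permuton: a measure on the unit square whose two marginals are the uniform measure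
on `[0,1]`. -/
def IsPermuton (μ : Measure (ℝ × ℝ)) : Prop :=
  μ.map Prod.fst = volume.restrict (Icc 0 1) ∧ μ.map Prod.snd = volume.restrict (Icc 0 1)

/-- The vertical band `[0,β] × [0,1]`. -/
def band (β : ℝ) : Set (ℝ × ℝ) := Icc 0 β ×ˢ Icc 0 1

/-- The uniform probability measure on the line segment from `(β,0)` to `(1,1)`. -/
def segmentLaw (β : ℝ) : Measure (ℝ × ℝ) :=
  (volume.restrict (Icc (0 : ℝ) 1)).map fun t => (β + (1 - β) * t, t)

/-- Mass `β` uniformly distributed on the band `[0,β] × [0,1]` (which has area `β`, so that this is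
Lebesgue measure on the band), plus mass `1 - β` uniformly distributed on the line segment from
`(β,0)` to `(1,1)`. It is meant for `0 < β ≤ 1`. -/
def bandPermuton (β : ℝ) : Measure (ℝ × ℝ) :=
  volume.restrict (band β) + ENNReal.ofReal (1 - β) • segmentLaw β

/-- The law of `n` independent points with distribution `μ`. -/
def sampleLaw (μ : Measure (ℝ × ℝ)) (n : ℕ) : Measure (Fin n → ℝ × ℝ) :=
  Measure.pi fun _ => μ

/-- The equation `c log (2e/c) = 1` has exactly one solution `c ≥ 2`. -/
theorem existsUnique_cStar :
    ∃! c : ℝ, 2 ≤ c ∧ c * Real.log (2 * Real.exp 1 / c) = 1 := by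
  have he : (1 : ℝ) ≤ Real.exp 1 := Real.one_le_exp (by norm_num)
  have hex : ∃ c : ℝ, 2 ≤ c ∧ c * Real.log (2 * Real.exp 1 / c) = 1 := by
    have hcont : ContinuousOn (fun c : ℝ => c * Real.log (2 * Real.exp 1 / c))
        (Icc 2 (2 * Real.exp 1)) := by
      intro c hc
      have hc0 : c ≠ 0 := by linarith [hc.1]
      have hq : 2 * Real.exp 1 / c ≠ 0 := by positivity
      exact (continuousAt_id.mul
        ((continuousAt_const.div continuousAt_id hc0).log hq)).continuousWithinAt
    have h := intermediate_value_Icc' (by linarith) hcont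
    have h1 : (1 : ℝ) ∈ Icc ((2 * Real.exp 1) * Real.log (2 * Real.exp 1 / (2 * Real.exp 1)))
        (2 * Real.log (2 * Real.exp 1 / 2)) := by
      rw [div_self (by positivity), mul_div_cancel_left₀ _ (by norm_num), Real.log_exp]
      simp
    obtain ⟨c, hc, h2⟩ := h h1
    exact ⟨c, hc.1, h2⟩
  have key : ∀ a b : ℝ, 2 ≤ a → a * Real.log (2 * Real.exp 1 / a) = 1 →
      b * Real.log (2 * Real.exp 1 / b) = 1 → a < b → False := by
    intro a b ha hfa hfb hab
    have ha0 : 0 < a := by linarith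
    have hb0 : 0 < b := by linarith
    have hA : Real.log (2 * Real.exp 1 / a) = Real.log (2 * Real.exp 1) - Real.log a :=
      Real.log_div (by positivity) ha0.ne'
    have hB : Real.log (2 * Real.exp 1 / b) = Real.log (2 * Real.exp 1) - Real.log b :=
      Real.log_div (by positivity) hb0.ne'
    have h1 := Real.one_sub_inv_le_log_of_pos (show 0 < b / a by positivity)
    rw [Real.log_div hb0.ne' ha0.ne', inv_div] at h1
    have h2 : (b - a) ≤ b * (Real.log b - Real.log a) := by
      calc b - a = b * (1 - a / b) := by field_simp
        _ ≤ _ := mul_le_mul_of_nonneg_left h1 hb0.le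
    rw [hA] at hfa
    rw [hB] at hfb
    nlinarith [mul_le_mul_of_nonneg_left h2 ha0.le]
  obtain ⟨c, hc⟩ := hex
  refine ⟨c, hc, fun d hd => ?_⟩
  rcases lt_trichotomy d c with h | h | h
  · exact (key d c hd.1 hd.2 hc.2 h).elim
  · exact h
  · exact (key c d hc.1 hc.2 hd.2 h).elim

/-- The constant `c* = 4.311…`: the unique solution `c ≥ 2` of `c log (2e/c) = 1`. -/
def cStar : ℝ := existsUnique_cStar.choose

/-- Convergence in probability, as `n → ∞`, of `X n` to the constant `a`, where `X n` is a function
of a sample of `n` independent points with distribution `μ`. -/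
def SampleTendstoInProbability (μ : Measure (ℝ × ℝ)) (X : ∀ n : ℕ, (Fin n → ℝ × ℝ) → ℝ)
    (a : ℝ) : Prop :=
  ∀ δ : ℝ, 0 < δ →
    Tendsto (fun n : ℕ => sampleLaw μ n {P | δ ≤ |X n P - a|}) atTop (𝓝 0)

end

/-!
The points of the band come first and cut `[0, 1]` into gaps. The points of the segment come
afterwards, with increasing `y`-coordinates, so those that fall into one gap form a path of the
tree which always turns right. It therefore suffices to find a gap with many points of the segment.

On the side of the trees: the height does not increase when a sequence is restricted to an interval
of labels (`height_bstOfList_filter_le`), and an increasing sequence of length `k` produces a path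
with `k` nodes. Hence a horizontal strip that contains exactly `k` sample points, all of them on
the segment, forces `k ≤ h + 1` (`le_bstHeight_of_mem_cellCountEvent`).

On the side of probability: cut the square into about `1 / q` strips of height
`q = log n / ((β + ε) n)`, and let `k` be one more than the mean number
`(1 - β) / (β + ε) * log n` of segment points in a strip, rounded up; the extra one is needed since
the height counts edges. A strip without points of the band, of
probability about `n ^ (-β / (β + ε))`, then has exactly `k` points of the segment with a
probability that is polynomial in `1 / log n`. So the expected number of good strips is
`n ^ (ε / (β + ε))` up to powers of `log n`. Good strips are almost pairwise independent: the
probability that two given strips are good is at most `(1 - q) ^ (-2 k)` times the square of the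
probability for one strip, and `k q → 0`. The second moment method
(`measureReal_compl_iUnion_cellCountEvent_le`, `tendsto_secondMomentBound`) shows that some strip
is good with probability tending to one. Prescribing the count `k` exactly, instead of bounding it
from below, makes both moments explicit.

The negative result follows, since `(1 - β) / (β + ε)` exceeds `cStar` for small `ε`.
-/

/-! ### Binary search trees of lists -/

section Trees

variable {α : Type*} [LinearOrder α]

lemma foldl_bstInsert_node (v : α) (L R : BinaryTree α) (l : List α) :
    l.foldl (fun t y => bstInsert y t) (.node v L R) =
      .node v ((l.filter (fun y => decide (y < v))).foldl (fun t y => bstInsert y t) L)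
        ((l.filter (fun y => !decide (y < v))).foldl (fun t y => bstInsert y t) R) := by
  induction l generalizing L R with
  | nil => rfl
  | cons y l ih =>
    by_cases h : y < v
    · simp [bstInsert, h, ih]
    · simp [bstInsert, h, ih]

/-- The first term of the sequence is the root; the later terms are distributed over the two
subtrees, keeping their order. -/
lemma bstOfList_cons (v : α) (l : List α) :
    bstOfList (v :: l) =
      .node v (bstOfList (l.filter fun y => decide (y < v)))
        (bstOfList (l.filter fun y => !decide (y < v))) := by
  simp only [bstOfList, List.foldl_cons, bstInsert]
  exact foldl_bstInsert_node v .nil .nil l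

/-- A weakly increasing sequence produces a path to the right: equal labels go to the right. -/
lemma height_bstOfList_of_pairwise_le {l : List α} (hl : l.Pairwise (· ≤ ·)) :
    (bstOfList l).height = l.length := by
  induction l with
  | nil => rfl
  | cons v l ih =>
    rw [List.pairwise_cons] at hl
    have h1 : (l.filter fun y => decide (y < v)) = [] := by
      simpa [List.filter_eq_nil_iff] using hl.1
    have h2 : (l.filter fun y => !decide (y < v)) = l := by
      simpa [List.filter_eq_self] using hl.1
    rw [bstOfList_cons, h1, h2]
    simp [bstOfList, BinaryTree.height, ← ih hl.2]

/-- Deleting the terms outside an interval does not increase the height: if the root is outside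
the interval, all the remaining terms lie on one side of it. -/
lemma height_bstOfList_filter_le {I : Set α} [DecidablePred (· ∈ I)] (hI : I.OrdConnected) :
    ∀ l : List α, (bstOfList (l.filter fun y => decide (y ∈ I))).height ≤ (bstOfList l).height
  | [] => le_rfl
  | v :: l => by
    have ihl := height_bstOfList_filter_le hI (l.filter fun y => decide (y < v))
    have ihr := height_bstOfList_filter_le hI (l.filter fun y => !decide (y < v))
    rw [List.filter_filter] at ihl ihr
    rw [bstOfList_cons, BinaryTree.height]
    by_cases hv : v ∈ I
    · rw [List.filter_cons_of_pos (by simpa using hv), bstOfList_cons, BinaryTree.height,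
        List.filter_filter, List.filter_filter]
      simp only [Bool.and_comm] at ihl ihr ⊢
      omega
    · rw [List.filter_cons_of_neg (by simpa using hv)]
      have hside : (∀ y ∈ I, y < v) ∨ ∀ y ∈ I, ¬ y < v := by
        by_contra! h
        obtain ⟨⟨a, ha, hav⟩, b, hb, hbv⟩ := h
        exact hv (hI.out hb ha ⟨hbv.le, hav⟩)
      rcases hside with h | h
      · have : (l.filter fun y => decide (y ∈ I)) =
            l.filter fun y => decide (y ∈ I) && decide (y < v) := by
          refine List.filter_congr fun y _ => ?_
          by_cases hy : y ∈ I
          · simp [hy, h y hy]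
          · simp [hy]
        rw [this]; omega
      · have : (l.filter fun y => decide (y ∈ I)) =
            l.filter fun y => decide (y ∈ I) && !decide (y < v) := by
          refine List.filter_congr fun y _ => ?_
          by_cases hy : y ∈ I
          · simpa [hy] using h y hy
          · simp [hy]
        rw [this]; omega
  termination_by l => l.length
  decreasing_by
    · exact Nat.lt_succ_of_le (List.length_filter_le _ _)
    · exact Nat.lt_succ_of_le (List.length_filter_le _ _)

end Trees

lemma countP_ySequence {n : ℕ} (P : Fin n → ℝ × ℝ) (p : ℝ → Bool) :
    (ySequence P).countP p = (Finset.univ.filter fun i => p (P i).2 = true).card := by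
  have h : (ySequence P).Perm (List.ofFn fun i => (P i).2) :=
    Equiv.Perm.ofFn_comp_perm (Tuple.sort fun j => (P j).1) fun i => (P i).2
  rw [h.countP_eq, List.ofFn_eq_map, List.countP_map, List.countP_eq_length_filter,
    Finset.card_def, Finset.filter_val, Fin.univ_def]
  simp [Function.comp_def]

/-- If the points whose `y`-coordinate lies in an interval `I` lie on the graph of a monotone
function of `x`, then they form a path in the tree. -/
lemma card_le_bstHeight_add_one {n : ℕ} (P : Fin n → ℝ × ℝ) {I : Set ℝ} (hI : I.OrdConnected)
    (hP : ∀ i j, (P i).2 ∈ I → (P j).2 ∈ I → (P i).1 ≤ (P j).1 → (P i).2 ≤ (P j).2)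
    {s : Finset (Fin n)} (hs : ∀ i ∈ s, (P i).2 ∈ I) :
    s.card ≤ bstHeight P + 1 := by
  classical
  have hpw : ((ySequence P).filter fun y => decide (y ∈ I)).Pairwise (· ≤ ·) := by
    rw [List.pairwise_filter, ySequence, List.pairwise_ofFn]
    intro i j hij hi hj
    refine hP _ _ (by simpa using hi) (by simpa using hj) ?_
    exact Tuple.monotone_sort (fun j => (P j).1) hij.le
  have h1 := height_bstOfList_filter_le hI (ySequence P)
  rw [height_bstOfList_of_pairwise_le hpw, ← List.countP_eq_length_filter,
    countP_ySequence] at h1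
  have h2 : s.card ≤ (Finset.univ.filter fun i => decide ((P i).2 ∈ I) = true).card :=
    Finset.card_le_card fun i hi => by simpa using hs i hi
  rw [bstHeight, edgeHeight, bstOfPoints]
  omega

/-! ### The second moment method for cells receiving exactly `k` sample points -/

section SecondMoment

/-- The second moment method for events of equal probability `p`: if the events are almost
pairwise independent, then with high probability at least one of them occurs. -/
lemma measureReal_compl_iUnion_mul_le {Ω ι : Type*} [MeasurableSpace Ω] [Fintype ι]
    (μ : Measure Ω) [IsProbabilityMeasure μ] {A : ι → Set Ω} (hA : ∀ i, MeasurableSet (A i))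
    {p r : ℝ} (hr : 0 ≤ r) (hp : ∀ i, μ.real (A i) = p)
    (hpair : ∀ i j, i ≠ j → μ.real (A i ∩ A j) ≤ r * p ^ 2) :
    μ.real (⋃ i, A i)ᶜ * (Fintype.card ι * p) ^ 2 ≤
      Fintype.card ι * p + (r - 1) * (Fintype.card ι * p) ^ 2 := by
  classical
  set a : ℝ := Fintype.card ι * p with ha
  let X : Ω → ℝ := fun ω => ∑ i, (A i).indicator 1 ω
  have hint1 : ∀ B : Set Ω, MeasurableSet B → Integrable (B.indicator (1 : Ω → ℝ)) μ :=
    fun B hB => (integrable_const (1 : ℝ)).indicator hB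
  have hX : Integrable X μ := integrable_finsetSum _ fun i _ => hint1 _ (hA i)
  have hXint : ∫ ω, X ω ∂μ = a := by
    rw [integral_finsetSum _ fun i _ => hint1 _ (hA i)]
    simp [integral_indicator_one (hA _), hp, ha]
  have hXsq : ∀ ω, X ω ^ 2 = ∑ i, ∑ j, (A i ∩ A j).indicator (1 : Ω → ℝ) ω := by
    intro ω
    rw [sq, Finset.sum_mul_sum]
    refine Finset.sum_congr rfl fun i _ => Finset.sum_congr rfl fun j _ => ?_
    rw [Set.inter_indicator_one]; rfl
  have hX2 : Integrable (fun ω => X ω ^ 2) μ := by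
    simp_rw [hXsq]
    exact integrable_finsetSum _ fun i _ => integrable_finsetSum _ fun j _ =>
      hint1 _ ((hA i).inter (hA j))
  have hX2int : ∫ ω, X ω ^ 2 ∂μ ≤ a + r * a ^ 2 := by
    simp_rw [hXsq]
    rw [integral_finsetSum _ fun i _ => integrable_finsetSum _ fun j _ =>
      hint1 _ ((hA i).inter (hA j))]
    calc ∑ i, ∫ ω, ∑ j, (A i ∩ A j).indicator (1 : Ω → ℝ) ω ∂μ
        ≤ ∑ _i : ι, (p + ∑ _j : ι, r * p ^ 2) := by
          refine Finset.sum_le_sum fun i _ => ?_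
          rw [integral_finsetSum _ fun j _ => hint1 _ ((hA i).inter (hA j))]
          simp_rw [integral_indicator_one ((hA i).inter (hA _))]
          rw [← Finset.add_sum_erase _ _ (Finset.mem_univ i), Set.inter_self, hp]
          refine add_le_add le_rfl ?_
          refine (Finset.sum_le_sum fun j hj => hpair i j (Finset.ne_of_mem_erase hj).symm).trans ?_
          exact Finset.sum_le_sum_of_subset_of_nonneg (Finset.erase_subset _ _)
            fun _ _ _ => by positivity
      _ = a + r * a ^ 2 := by
          simp only [Finset.sum_const, Finset.card_univ, nsmul_eq_mul, ha]; ring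
  have hmeas : MeasurableSet (⋃ i, A i)ᶜ := (MeasurableSet.iUnion hA).compl
  -- On the complement of the union `X = 0`, hence `(X - a) ^ 2 = a ^ 2` there.
  have hle : ∫ ω, ((⋃ i, A i)ᶜ).indicator (1 : Ω → ℝ) ω * a ^ 2 ∂μ ≤
      ∫ ω, (X ω ^ 2 - 2 * a * X ω + a ^ 2) ∂μ := by
    refine integral_mono ((hint1 _ hmeas).mul_const _)
      ((hX2.sub (hX.const_mul _)).add (integrable_const _)) fun ω => ?_
    by_cases hω : ω ∈ (⋃ i, A i)ᶜ
    · have h0 : X ω = 0 := Finset.sum_eq_zero fun i _ => Set.indicator_of_notMem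
        (fun h => hω (mem_iUnion.2 ⟨i, h⟩)) _
      rw [Set.indicator_of_mem hω, h0]; simp
    · simp only [Set.indicator_of_notMem hω, zero_mul]
      nlinarith [sq_nonneg (X ω - a)]
  rw [integral_mul_const, integral_indicator_one hmeas,
    integral_add (f := fun ω => X ω ^ 2 - 2 * a * X ω) (hX2.sub (hX.const_mul _))
      (integrable_const _),
    integral_sub hX2 (hX.const_mul _), integral_const_mul, hXint] at hle
  simp only [integral_const, probReal_univ, one_smul] at hle
  nlinarith

/-- The event that exactly the points with index in `s` lie in the cell `C`, and that these points
even lie in its subset `B`. -/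
def cellEvent {X : Type*} {n : ℕ} (B C : Set X) (s : Finset (Fin n)) : Set (Fin n → X) :=
  Set.univ.pi fun j => if j ∈ s then B else Cᶜ

/-- The event that exactly `k` of the points lie in the cell `C`, and that these points even lie
in its subset `B`. -/
def cellCountEvent {X : Type*} {n : ℕ} (B C : Set X) (k : ℕ) : Set (Fin n → X) :=
  ⋃ s ∈ Finset.powersetCard k (Finset.univ : Finset (Fin n)), cellEvent B C s

lemma mem_cellEvent {X : Type*} {n : ℕ} {B C : Set X} {s : Finset (Fin n)} {P : Fin n → X} :
    P ∈ cellEvent B C s ↔ ∀ j, if j ∈ s then P j ∈ B else P j ∉ C := by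
  simp only [cellEvent, Set.mem_pi, mem_univ, true_imp_iff]
  refine forall_congr' fun j => ?_
  split_ifs <;> simp

variable {X : Type*} [MeasurableSpace X] {n : ℕ}

lemma measurableSet_cellEvent {B C : Set X} (hB : MeasurableSet B) (hC : MeasurableSet C)
    (s : Finset (Fin n)) : MeasurableSet (cellEvent B C s) :=
  MeasurableSet.univ_pi fun j => by split_ifs; exacts [hB, hC.compl]

lemma measurableSet_cellCountEvent {B C : Set X} (hB : MeasurableSet B) (hC : MeasurableSet C)
    (k : ℕ) : MeasurableSet (cellCountEvent (n := n) B C k) :=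
  Finset.measurableSet_biUnion _ fun s _ => measurableSet_cellEvent hB hC s

lemma measureReal_pi_univ (μ : Measure X) [IsProbabilityMeasure μ] (S : Fin n → Set X) :
    (Measure.pi fun _ : Fin n => μ).real (Set.univ.pi S) = ∏ j, μ.real (S j) := by
  simp [Measure.real, Measure.pi_pi, ENNReal.toReal_prod]

lemma measureReal_cellCountEvent (μ : Measure X) [IsProbabilityMeasure μ] {B C : Set X}
    (hB : MeasurableSet B) (hC : MeasurableSet C) (hBC : B ⊆ C) (k : ℕ) :
    (Measure.pi fun _ : Fin n => μ).real (cellCountEvent B C k) =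
      n.choose k * (μ.real B ^ k * (1 - μ.real C) ^ (n - k)) := by
  have hdisj : Set.PairwiseDisjoint
      (Finset.powersetCard k (Finset.univ : Finset (Fin n)) : Set (Finset (Fin n))) (cellEvent B C) := by
    intro s _ t _ hst
    refine Set.disjoint_left.2 fun P hs ht => hst ?_
    ext j
    have h1 := mem_cellEvent.1 hs j
    have h2 := mem_cellEvent.1 ht j
    by_cases hjs : j ∈ s <;> by_cases hjt : j ∈ t <;> simp only [hjs, hjt, if_true, if_false] at *
    · exact (h2 (hBC h1)).elim
    · exact (h1 (hBC h2)).elim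
  rw [cellCountEvent, measureReal_biUnion_finset hdisj fun s _ => measurableSet_cellEvent hB hC s]
  have h : ∀ s ∈ Finset.powersetCard k (Finset.univ : Finset (Fin n)),
      (Measure.pi fun _ : Fin n => μ).real (cellEvent B C s) =
        μ.real B ^ k * (1 - μ.real C) ^ (n - k) := by
    intro s hs
    have hsk := (Finset.mem_powersetCard.1 hs).2
    rw [cellEvent, measureReal_pi_univ]
    simp only [apply_ite μ.real, probReal_compl_eq_one_sub hC]
    rw [Finset.prod_ite]
    simp [hsk, Finset.filter_not, Finset.card_univ_sdiff]
  rw [Finset.sum_congr rfl h]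
  simp [Finset.card_powersetCard]

/-- Two disjoint cells: only pairs of disjoint index sets contribute, and
`1 - 2q ≤ (1 - q)²`. -/
lemma measureReal_cellCountEvent_inter_le (μ : Measure X) [IsProbabilityMeasure μ]
    {B C B' C' : Set X} (hB' : B' ⊆ C') (hBC : B ⊆ C)
    (hC : MeasurableSet C) (hC' : MeasurableSet C') (hdisj : Disjoint C C') {b q : ℝ}
    (hb : μ.real B = b) (hb' : μ.real B' = b) (hq : μ.real C = q) (hq' : μ.real C' = q)
    (k : ℕ) :
    (Measure.pi fun _ : Fin n => μ).real (cellCountEvent B C k ∩ cellCountEvent B' C' k) ≤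
      (n.choose k : ℝ) ^ 2 * (b ^ (2 * k) * (1 - q) ^ (2 * (n - 2 * k))) := by
  classical
  set ν := Measure.pi fun _ : Fin n => μ
  set F := Finset.powersetCard k (Finset.univ : Finset (Fin n)) with hF
  have hb0 : 0 ≤ b := hb ▸ measureReal_nonneg
  have hq1 : 0 ≤ 1 - q := by rw [← hq]; linarith [measureReal_le_one (μ := μ) (s := C)]
  have hsub : cellCountEvent B C k ∩ cellCountEvent B' C' k ⊆
      ⋃ st ∈ F ×ˢ F, cellEvent (n := n) B C st.1 ∩ cellEvent B' C' st.2 := by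
    rintro P ⟨h1, h2⟩
    simp only [cellCountEvent, mem_iUnion] at h1 h2 ⊢
    obtain ⟨s, hs, h1⟩ := h1
    obtain ⟨t, ht, h2⟩ := h2
    exact ⟨(s, t), Finset.mk_mem_product hs ht, h1, h2⟩
  have hterm : ∀ st ∈ F ×ˢ F, ν.real (cellEvent (n := n) B C st.1 ∩ cellEvent B' C' st.2) ≤
      b ^ (2 * k) * (1 - q) ^ (2 * (n - 2 * k)) := by
    rintro ⟨s, t⟩ hst
    obtain ⟨hs, ht⟩ := Finset.mem_product.1 hst
    have hsk := (Finset.mem_powersetCard.1 hs).2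
    have htk := (Finset.mem_powersetCard.1 ht).2
    dsimp only at hsk htk ⊢
    by_cases hd : Disjoint s t
    · have hinc : cellEvent (n := n) B C s ∩ cellEvent B' C' t ⊆
          Set.univ.pi fun j => if j ∈ s then B else if j ∈ t then B' else (C ∪ C')ᶜ := by
        rintro P ⟨h1, h2⟩ j -
        have h1 := mem_cellEvent.1 h1 j
        have h2 := mem_cellEvent.1 h2 j
        dsimp only
        split_ifs with hjs hjt
        · simpa [hjs] using h1
        · simpa [hjt] using h2
        · simp only [hjs, hjt, if_false] at h1 h2
          simp [h1, h2]
      refine (measureReal_mono hinc).trans ?_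
      rw [measureReal_pi_univ]
      have hun : μ.real (C ∪ C')ᶜ = 1 - 2 * q := by
        rw [probReal_compl_eq_one_sub (hC.union hC'), measureReal_union hdisj hC', hq, hq']; ring
      simp only [apply_ite μ.real, hb, hb', hun]
      have hprod : (∏ j : Fin n, if j ∈ s then b else if j ∈ t then b else 1 - 2 * q) =
          b ^ (2 * k) * (1 - 2 * q) ^ (n - 2 * k) := by
        have : ∀ j : Fin n, (if j ∈ s then b else if j ∈ t then b else 1 - 2 * q) =
            if j ∈ s ∪ t then b else 1 - 2 * q := fun j => by
          by_cases hjs : j ∈ s <;> by_cases hjt : j ∈ t <;> simp [hjs, hjt]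
        simp only [this]
        rw [Finset.prod_ite, Finset.prod_const, Finset.prod_const, Finset.filter_not]
        have hcard : (s ∪ t).card = 2 * k := by rw [Finset.card_union_of_disjoint hd]; omega
        simp only [Finset.filter_univ_mem, Finset.card_univ_sdiff, Fintype.card_fin, hcard]
      rw [hprod]
      have h2q : 0 ≤ 1 - 2 * q := hun ▸ measureReal_nonneg
      rw [pow_mul (1 - q)]
      gcongr
      nlinarith [sq_nonneg q]
    · have : cellEvent (n := n) B C s ∩ cellEvent B' C' t = ∅ := by
        obtain ⟨j, hjs, hjt⟩ := Finset.not_disjoint_iff.1 hd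
        refine Set.eq_empty_of_forall_notMem fun P ⟨h1, h2⟩ => ?_
        have h1 := mem_cellEvent.1 h1 j
        have h2 := mem_cellEvent.1 h2 j
        simp only [hjs, hjt, if_true] at h1 h2
        exact Set.disjoint_left.1 hdisj (hBC h1) (hB' h2)
      rw [this]
      simp only [measureReal_empty]
      positivity
  calc _ ≤ ν.real (⋃ st ∈ F ×ˢ F, cellEvent (n := n) B C st.1 ∩ cellEvent B' C' st.2) :=
        measureReal_mono hsub (measure_ne_top _ _)
    _ ≤ ∑ st ∈ F ×ˢ F, ν.real (cellEvent (n := n) B C st.1 ∩ cellEvent B' C' st.2) :=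
        measureReal_biUnion_finset_le _ _
    _ ≤ ∑ st ∈ F ×ˢ F, b ^ (2 * k) * (1 - q) ^ (2 * (n - 2 * k)) := Finset.sum_le_sum hterm
    _ = _ := by
        rw [Finset.sum_const, Finset.card_product, hF, Finset.card_powersetCard,
          Finset.card_univ, Fintype.card_fin, nsmul_eq_mul]
        push_cast
        ring

/-- Among `m` disjoint cells of mass `q`, each with a part of mass `b`, the probability that none
of them receives exactly `k` points, all of them in the marked part, is small as soon as the
expected number of such cells is large and `k * q` is small. -/
lemma measureReal_compl_iUnion_cellCountEvent_le (μ : Measure X) [IsProbabilityMeasure μ] {m : ℕ}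
    (B C : Fin m → Set X) (hB : ∀ i, MeasurableSet (B i)) (hC : ∀ i, MeasurableSet (C i))
    (hBC : ∀ i, B i ⊆ C i) (hdisj : Pairwise fun i j => Disjoint (C i) (C j)) {b q : ℝ}
    (hb : ∀ i, μ.real (B i) = b) (hq : ∀ i, μ.real (C i) = q) (hb0 : 0 < b) (hq1 : q < 1)
    (hm : 0 < m) {k : ℕ} (hk : 2 * k ≤ n) :
    (Measure.pi fun _ : Fin n => μ).real (⋃ i, cellCountEvent (B i) (C i) k)ᶜ ≤
      (m * (n.choose k * (b ^ k * (1 - q) ^ (n - k))))⁻¹ + (((1 - q) ^ (2 * k))⁻¹ - 1) := by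
  set p : ℝ := n.choose k * (b ^ k * (1 - q) ^ (n - k)) with hp
  have h1q : 0 < 1 - q := by linarith
  have hp0 : 0 < p := by
    have : 0 < n.choose k := Nat.choose_pos (by omega)
    positivity
  have hmain := measureReal_compl_iUnion_mul_le (Measure.pi fun _ : Fin n => μ)
    (A := fun i => cellCountEvent (B i) (C i) k) (p := p) (r := ((1 - q) ^ (2 * k))⁻¹)
    (fun i => measurableSet_cellCountEvent (hB i) (hC i) k) (by positivity)
    (fun i => by rw [measureReal_cellCountEvent μ (hB i) (hC i) (hBC i), hb, hq])
    (fun i j hij => by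
      refine (measureReal_cellCountEvent_inter_le μ (hBC j) (hBC i) (hC i) (hC j) (hdisj hij)
        (hb i) (hb j) (hq i) (hq j) k).trans_eq ?_
      have h : (1 - q) ^ (2 * (n - k)) = (1 - q) ^ (2 * (n - 2 * k)) * (1 - q) ^ (2 * k) := by
        rw [← pow_add]; congr 1; omega
      rw [hp, mul_pow, mul_pow, ← pow_mul, ← pow_mul, mul_comm k 2, mul_comm (n - k) 2, h]
      field_simp)
  rw [Fintype.card_fin] at hmain
  set a : ℝ := m * p with ha
  have ha0 : 0 < a := by positivity
  have : (Measure.pi fun _ : Fin n => μ).real (⋃ i, cellCountEvent (B i) (C i) k)ᶜ ≤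
      (a + (((1 - q) ^ (2 * k))⁻¹ - 1) * a ^ 2) / a ^ 2 := by
    rw [le_div_iff₀ (by positivity)]; exact hmain
  refine this.trans_eq ?_
  field_simp

end SecondMoment

/-! ### Asymptotics of the expected number of good strips -/

section Asymptotics

lemma factorial_mul_exp_le (k : ℕ) :
    ((k + 1).factorial : ℝ) * Real.exp k ≤ (k + 1 : ℝ) ^ (k + 2) := by
  induction k with
  | zero => simp
  | succ k ih =>
    -- This is `1 - 1 / (k + 2) ≤ exp (-1 / (k + 2))`, raised to the power `k + 2`.
    have hstep : (k + 1 : ℝ) ^ (k + 2) * Real.exp 1 ≤ (k + 2 : ℝ) ^ (k + 2) := by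
      have h := Real.add_one_le_exp (-(1 / (k + 2 : ℝ)))
      have h2 : (k + 1 : ℝ) ≤ (k + 2) * Real.exp (-(1 / (k + 2 : ℝ))) := by
        have hk : (0 : ℝ) < k + 2 := by positivity
        calc (k + 1 : ℝ) = (k + 2) * (-(1 / (k + 2 : ℝ)) + 1) := by field_simp; ring
          _ ≤ _ := by gcongr
      calc (k + 1 : ℝ) ^ (k + 2) * Real.exp 1
          ≤ ((k + 2) * Real.exp (-(1 / (k + 2 : ℝ)))) ^ (k + 2) * Real.exp 1 := by gcongr
        _ = (k + 2 : ℝ) ^ (k + 2) := by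
          rw [mul_pow, ← Real.exp_nat_mul, mul_assoc, ← Real.exp_add]
          push_cast
          rw [show (k + 2 : ℝ) * -(1 / (k + 2)) + 1 = 0 by field_simp; ring, Real.exp_zero,
            mul_one]
    rw [Nat.factorial_succ]
    push_cast
    rw [Real.exp_add]
    calc ((k : ℝ) + 1 + 1) * (k + 1).factorial * (Real.exp k * Real.exp 1)
        = ((k : ℝ) + 2) * Real.exp 1 * ((k + 1).factorial * Real.exp k) := by ring
      _ ≤ ((k : ℝ) + 2) * Real.exp 1 * (k + 1) ^ (k + 2) := by gcongr
      _ = ((k : ℝ) + 2) * ((k + 1) ^ (k + 2) * Real.exp 1) := by ring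
      _ ≤ ((k : ℝ) + 2) * (k + 2) ^ (k + 2) := by gcongr
      _ = ((k : ℝ) + 1 + 1) ^ (k + 1 + 2) := by ring

/-- Near its mean `x`, the Poisson distribution has weights at least of the order `1 / x`. -/
lemma exp_sub_le_pow_div_factorial {x : ℝ} {k : ℕ} (hx : 1 ≤ x) (h1 : x + 1 ≤ k)
    (h2 : (k : ℝ) ≤ x + 2) : Real.exp (x - 6) / k ≤ x ^ k / k.factorial := by
  have hx0 : 0 < x := by linarith
  have hk0 : (0 : ℝ) < k := by linarith
  obtain ⟨j, rfl⟩ : ∃ j, k = j + 1 := Nat.exists_eq_succ_of_ne_zero (by rintro rfl; simp at hk0)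
  have hf := factorial_mul_exp_le j
  push_cast at *
  -- `(k / x) ^ k ≤ exp (k (k - x) / x) ≤ exp 6`
  have hpow : (j + 1 : ℝ) ^ (j + 1) ≤ x ^ (j + 1) * Real.exp 6 := by
    have h3 : (j + 1 : ℝ) ≤ x * Real.exp (2 / x) := by
      have := Real.add_one_le_exp (2 / x)
      calc (j + 1 : ℝ) ≤ x * (2 / x + 1) := by field_simp; linarith
        _ ≤ _ := by gcongr
    calc (j + 1 : ℝ) ^ (j + 1) ≤ (x * Real.exp (2 / x)) ^ (j + 1) := by gcongr
      _ = x ^ (j + 1) * Real.exp ((j + 1) * (2 / x)) := by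
        rw [mul_pow, ← Real.exp_nat_mul]; push_cast; ring
      _ ≤ _ := by
        gcongr
        rw [mul_div_assoc', div_le_iff₀ hx0]; linarith
  rw [div_le_div_iff₀ hk0 (by positivity)]
  calc Real.exp (x - 6) * (j + 1).factorial
      ≤ Real.exp (j - 6) * (j + 1).factorial := by gcongr; linarith
    _ = ((j + 1).factorial * Real.exp j) * Real.exp (-6) := by
        rw [sub_eq_add_neg, Real.exp_add]; ring
    _ ≤ (j + 1 : ℝ) ^ (j + 2) * Real.exp (-6) := by gcongr
    _ = (j + 1 : ℝ) ^ (j + 1) * ((j + 1) * Real.exp (-6)) := by ring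
    _ ≤ x ^ (j + 1) * Real.exp 6 * ((j + 1) * Real.exp (-6)) := by gcongr
    _ = x ^ (j + 1) * (j + 1) := by
        rw [Real.exp_neg]; field_simp

/-- Poisson lower bound for a multinomial weight, `x = n b` being the mean number of points in the
marked part of the cell. -/
lemma exp_le_choose_mul {n k : ℕ} {x q : ℝ} (hx : 1 ≤ x) (h1 : x + 1 ≤ k) (h2 : (k : ℝ) ≤ x + 2)
    (hkn : 2 * (k : ℝ) ^ 2 ≤ n) (hq0 : 0 ≤ q) (hq : q ≤ 1 / 2) (hnq : 2 * (n * q ^ 2) ≤ 1) :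
    Real.exp (x - n * q - 7) / (2 * k) ≤ n.choose k * ((x / n) ^ k * (1 - q) ^ (n - k)) := by
  have hx0 : 0 < x := by linarith
  have hk0 : (0 : ℝ) < k := by linarith
  have hn0 : (0 : ℝ) < n := lt_of_lt_of_le (by positivity) hkn
  have hkn' : (k : ℝ) ≤ n := by nlinarith
  have hchoose : (1 / 2 : ℝ) * (n : ℝ) ^ k / k.factorial ≤ n.choose k := by
    refine le_trans ?_ (Nat.pow_le_choose (α := ℝ) k n)
    have h3 : (1 / 2 : ℝ) ≤ (1 + -((k : ℝ) / n)) ^ k := by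
      have h := one_add_mul_le_pow (a := -((k : ℝ) / n))
        (by have := (div_le_one hn0).2 hkn'; linarith) k
      have h4 : (k : ℝ) * (k / n) ≤ 1 / 2 := by
        rw [mul_div_assoc', div_le_iff₀ hn0]; nlinarith
      linarith
    gcongr
    calc (1 / 2 : ℝ) * (n : ℝ) ^ k ≤ (1 + -((k : ℝ) / n)) ^ k * (n : ℝ) ^ k := by gcongr
      _ = ((n : ℝ) - k) ^ k := by rw [← mul_pow]; congr 1; field_simp; ring
      _ ≤ _ := by
        have h4 : (0 : ℝ) ≤ n - k := by linarith
        gcongr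
        · have : k ≤ n := by exact_mod_cast hkn'
          rw [Nat.cast_sub (by omega)]; push_cast; linarith
  have hq1 : Real.exp (-(n * q) - 1) ≤ (1 - q) ^ (n - k) := by
    have h5 : Real.exp (-q - 2 * q ^ 2) ≤ 1 - q := by
      rw [← Real.le_log_iff_exp_le (by linarith)]
      refine le_trans ?_ (Real.one_sub_inv_le_log_of_pos (by linarith))
      have h6 : (1 - q)⁻¹ ≤ 1 + q + 2 * q ^ 2 := by
        rw [inv_le_iff_one_le_mul₀ (by linarith)]; nlinarith [sq_nonneg q, mul_nonneg hq0 hq0]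
      linarith
    calc Real.exp (-(n * q) - 1) ≤ Real.exp (n * (-q - 2 * q ^ 2)) := by
          apply Real.exp_le_exp.2; linarith
      _ = Real.exp (-q - 2 * q ^ 2) ^ n := by rw [Real.exp_nat_mul]
      _ ≤ (1 - q) ^ n := by gcongr
      _ ≤ _ := pow_le_pow_of_le_one (by linarith) (by linarith) (Nat.sub_le _ _)
  calc Real.exp (x - n * q - 7) / (2 * k)
      = 1 / 2 * (Real.exp (x - 6) / k) * Real.exp (-(n * q) - 1) := by
        rw [show x - n * q - 7 = (x - 6) + (-(n * q) - 1) by ring, Real.exp_add]; field_simp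
    _ ≤ 1 / 2 * (x ^ k / k.factorial) * (1 - q) ^ (n - k) := by
        have h7 := exp_sub_le_pow_div_factorial hx h1 h2
        have h8 : 0 ≤ 1 - q := by linarith
        exact mul_le_mul (mul_le_mul_of_nonneg_left h7 (by norm_num)) hq1 (Real.exp_nonneg _)
          (by positivity)
    _ = (1 / 2 * (n : ℝ) ^ k / k.factorial) * ((x / n) ^ k * (1 - q) ^ (n - k)) := by
        rw [div_pow]; field_simp
    _ ≤ _ := by
        have : 0 ≤ 1 - q := by linarith
        gcongr

lemma tendsto_log_pow_div_natCast (j : ℕ) :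
    Tendsto (fun n : ℕ => Real.log n ^ j / n) atTop (𝓝 0) := by
  have h := (isLittleO_log_rpow_rpow_atTop (j : ℝ) (zero_lt_one)).tendsto_div_nhds_zero
  refine (h.comp tendsto_natCast_atTop_atTop).congr fun n => ?_
  simp

lemma tendsto_log_sq_mul_exp {s : ℝ} (hs : 0 < s) :
    Tendsto (fun n : ℕ => Real.log n ^ 2 * Real.exp (-(s * Real.log n))) atTop (𝓝 0) := by
  have h := (isLittleO_log_rpow_rpow_atTop (2 : ℝ) hs).tendsto_div_nhds_zero
  refine (h.comp tendsto_natCast_atTop_atTop).congr' ?_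
  filter_upwards [eventually_gt_atTop 0] with n hn
  have hn0 : (0 : ℝ) < n := by exact_mod_cast hn
  simp only [Function.comp]
  rw [Real.rpow_def_of_pos hn0, Real.exp_neg, div_eq_mul_inv, mul_comm s]
  norm_num

/-- The failure probability of the second moment method tends to zero for strips of height
`q = l log n / n`, when a fraction `γ` of their mass is marked and `k` is `γ l log n`, rounded up,
plus one. The expected number of good strips is `n ^ (1 - (1 - γ) l)` up to logarithms. -/
lemma tendsto_secondMomentBound {l γ : ℝ} (hl : 0 < l) (hγ : 0 < γ)
    (hlγ : (1 - γ) * l < 1) :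
    Tendsto (fun n : ℕ =>
      (⌊(l * Real.log n / n)⁻¹⌋₊ * (n.choose (⌈γ * l * Real.log n⌉₊ + 1) *
        ((γ * (l * Real.log n / n)) ^ (⌈γ * l * Real.log n⌉₊ + 1) *
          (1 - l * Real.log n / n) ^ (n - (⌈γ * l * Real.log n⌉₊ + 1)))) : ℝ)⁻¹ +
      (((1 - l * Real.log n / n) ^ (2 * (⌈γ * l * Real.log n⌉₊ + 1)))⁻¹ - 1))
      atTop (𝓝 0) := by
  have hlog : Tendsto (fun n : ℕ => Real.log n) atTop atTop :=
    Real.tendsto_log_atTop.comp tendsto_natCast_atTop_atTop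
  have hx : ∀ᶠ n : ℕ in atTop, 1 ≤ γ * l * Real.log n :=
    (hlog.const_mul_atTop (by positivity : 0 < γ * l)).eventually_ge_atTop 1
  have hL : ∀ᶠ n : ℕ in atTop, 1 ≤ Real.log n := hlog.eventually_ge_atTop 1
  have hqlim : Tendsto (fun n : ℕ => l * Real.log n / n) atTop (𝓝 0) := by
    simpa [mul_div_assoc] using (tendsto_log_pow_div_natCast 1).const_mul l
  have hq : ∀ᶠ n : ℕ in atTop, l * Real.log n / n ≤ 1 / 2 :=
    hqlim.eventually_le_const (by norm_num)
  have hsq : ∀ c : ℝ, ∀ᶠ n : ℕ in atTop, c * (Real.log n ^ 2 / n) ≤ 1 := fun c => by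
    have := (tendsto_log_pow_div_natCast 2).const_mul c
    rw [mul_zero] at this
    exact this.eventually_le_const (by norm_num)
  have hk2 : ∀ᶠ n : ℕ in atTop, ((⌈γ * l * Real.log n⌉₊ + 1 : ℕ) : ℝ) ≤ γ * l * Real.log n + 2 := by
    filter_upwards [hx] with n h
    have := (Nat.ceil_lt_add_one (by linarith : 0 ≤ γ * l * Real.log n)).le
    push_cast; linarith
  rw [← add_zero (0 : ℝ)]
  refine Tendsto.add ?_ ?_
  · -- `1 / (m p) ≤ const * (log n) ^ 2 * n ^ (-(1 - (1 - γ) l))`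
    have hlim := (tendsto_log_sq_mul_exp (sub_pos.2 hlγ)).const_mul
      (12 * Real.exp 7 * (γ * l * l))
    rw [mul_zero] at hlim
    refine squeeze_zero' ?_ ?_ hlim
    · filter_upwards [hL, hq] with n h1 h2
      have : 0 ≤ 1 - l * Real.log n / n := by linarith
      positivity
    · filter_upwards [hx, hL, hq, hk2, hsq (2 * (9 * (γ * l) ^ 2)), hsq (2 * l ^ 2),
        eventually_gt_atTop 0] with n hx1 hL1 hq1 hk hs1 hs2 hn
      have hn0 : (0 : ℝ) < n := by exact_mod_cast hn
      have hk1 : γ * l * Real.log n + 1 ≤ ((⌈γ * l * Real.log n⌉₊ + 1 : ℕ) : ℝ) := by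
        push_cast; linarith [Nat.le_ceil (γ * l * Real.log n)]
      set L := Real.log n with hLdef
      set k := ⌈γ * l * L⌉₊ + 1 with hkdef
      set q := l * L / n with hqdef
      have hq0 : 0 < q := by positivity
      have hnq : n * q = l * L := by rw [hqdef]; field_simp
      have hk3 : (k : ℝ) ≤ 3 * (γ * l * L) := by linarith
      have hk0 : (0 : ℝ) < k := by linarith
      have hp := exp_le_choose_mul (n := n) (k := k) (x := γ * l * L) (q := q) hx1 hk1 hk
        (by
          rw [mul_div_assoc', div_le_one hn0] at hs1
          have : (k : ℝ) ^ 2 ≤ (3 * (γ * l * L)) ^ 2 := by gcongr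
          nlinarith)
        hq0.le hq1
        (by
          have : 2 * (n * q ^ 2) = 2 * l ^ 2 * (L ^ 2 / n) := by rw [hqdef]; field_simp
          rw [this]; exact hs2)
      rw [show γ * l * L / n = γ * q by rw [hqdef]; ring] at hp
      have hm : 1 / (2 * q) ≤ (⌊q⁻¹⌋₊ : ℝ) := by
        have h1 := (Nat.lt_floor_add_one q⁻¹).le
        have h2 : 1 / (2 * q) = q⁻¹ / 2 := by field_simp
        have h3 : 2 ≤ q⁻¹ := by rw [le_inv_comm₀ (by norm_num) hq0]; linarith
        linarith
      have hmp := mul_le_mul hm hp (by positivity) (by positivity)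
      refine (inv_anti₀ (by positivity) hmp).trans ?_
      have hexp : Real.exp (γ * l * L - n * q - 7) =
          (n * Real.exp (-((1 - (1 - γ) * l) * L)) * Real.exp 7)⁻¹ := by
        rw [show γ * l * L - n * q - 7 = -(L + -((1 - (1 - γ) * l) * L) + 7) by rw [hnq]; ring,
          Real.exp_neg, Real.exp_add, Real.exp_add, hLdef, Real.exp_log hn0]
      calc (1 / (2 * q) * (Real.exp (γ * l * L - n * q - 7) / (2 * k)))⁻¹
          = 4 * (n * q) * k * Real.exp (-((1 - (1 - γ) * l) * L)) * Real.exp 7 := by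
            rw [hexp]; field_simp; norm_num
        _ ≤ 4 * (n * q) * (3 * (γ * l * L)) * Real.exp (-((1 - (1 - γ) * l) * L)) *
              Real.exp 7 := by gcongr
        _ = _ := by rw [hnq]; ring
  · have hlim : Tendsto (fun n : ℕ =>
        (1 - l * Real.log n / n) ^ (2 * (⌈γ * l * Real.log n⌉₊ + 1))) atTop (𝓝 1) := by
      have hlow : Tendsto (fun n : ℕ => 1 - 6 * (γ * l * l) * (Real.log n ^ 2 / n)) atTop
          (𝓝 1) := by
        simpa using ((tendsto_log_pow_div_natCast 2).const_mul (6 * (γ * l * l))).const_sub 1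
      refine tendsto_of_tendsto_of_tendsto_of_le_of_le' hlow tendsto_const_nhds ?_ ?_
      · filter_upwards [hx, hL, hq, hk2, eventually_gt_atTop 0] with n hx1 hL1 hq1 hk hn
        have hn0 : (0 : ℝ) < n := by exact_mod_cast hn
        have h := one_add_mul_le_pow (a := -(l * Real.log n / n)) (by linarith)
          (2 * (⌈γ * l * Real.log n⌉₊ + 1))
        rw [← sub_eq_add_neg] at h
        refine le_trans ?_ h
        have hk3 : ((⌈γ * l * Real.log n⌉₊ + 1 : ℕ) : ℝ) ≤ 3 * (γ * l * Real.log n) := by linarith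
        have hq0 : 0 ≤ l * Real.log n / n := by positivity
        have := mul_le_mul_of_nonneg_right hk3 hq0
        have h4 : 6 * (γ * l * l) * (Real.log n ^ 2 / n) =
          2 * (3 * (γ * l * Real.log n) * (l * Real.log n / n)) := by ring
        rw [h4, Nat.cast_mul]
        push_cast at this ⊢
        linarith
      · filter_upwards [hL, hq] with n h1 h2
        exact pow_le_one₀ (by linarith) (by have : 0 ≤ l * Real.log n / n := by positivity
                                            linarith)
    simpa using (hlim.inv₀ one_ne_zero).sub_const 1

end Asymptotics

/-! ### The measure `bandPermuton β` -/

section BandPermuton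

variable {β : ℝ}

lemma volume_restrict_band (β : ℝ) :
    (volume : Measure (ℝ × ℝ)).restrict (band β) =
      (volume.restrict (Icc 0 β)).prod (volume.restrict (Icc (0 : ℝ) 1)) := by
  rw [band, Measure.volume_eq_prod, Measure.prod_restrict]

lemma measurable_segment (β : ℝ) : Measurable fun t : ℝ => (β + (1 - β) * t, t) := by
  fun_prop

lemma measurableSet_band (β : ℝ) : MeasurableSet (band β) :=
  measurableSet_Icc.prod measurableSet_Icc

/-- The affine map `t ↦ β + (1 - β) t` contracts lengths by the factor `1 - β`. -/
lemma map_affine_volume_Icc (h0 : β < 1) :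
    ENNReal.ofReal (1 - β) • (volume.restrict (Icc (0 : ℝ) 1)).map (fun t => β + (1 - β) * t) =
      volume.restrict (Icc β 1) := by
  have h1 : 0 < 1 - β := by linarith
  have hpre : Icc (0 : ℝ) 1 = (fun t => β + (1 - β) * t) ⁻¹' Icc β 1 := by
    ext t
    simp only [mem_Icc, mem_preimage]
    constructor
    · rintro ⟨h, h'⟩; constructor <;> nlinarith
    · rintro ⟨h, h'⟩; constructor <;> by_contra! <;> nlinarith
  have hmap : (volume : Measure ℝ).map (fun t => β + (1 - β) * t) =
      ENNReal.ofReal (1 - β)⁻¹ • volume := by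
    have : (fun t : ℝ => β + (1 - β) * t) = (fun t => β + t) ∘ fun t => (1 - β) * t := rfl
    rw [this, ← Measure.map_map (by fun_prop) (by fun_prop), Real.map_volume_mul_left h1.ne',
      Measure.map_smul, map_add_left_eq_self, abs_of_pos (by positivity)]
  rw [hpre, ← Measure.restrict_map (by fun_prop) measurableSet_Icc, hmap, Measure.restrict_smul,
    smul_smul, ← ENNReal.ofReal_mul h1.le, mul_inv_cancel₀ h1.ne', ENNReal.ofReal_one, one_smul]

lemma map_fst_bandPermuton (h0 : 0 < β) (h1 : β ≤ 1) :
    (bandPermuton β).map Prod.fst = volume.restrict (Icc 0 1) := by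
  rw [bandPermuton, Measure.map_add _ _ measurable_fst, Measure.map_smul, segmentLaw,
    Measure.map_map measurable_fst (measurable_segment β), volume_restrict_band]
  have hfst : (((volume : Measure ℝ).restrict (Icc 0 β)).prod
      (volume.restrict (Icc (0 : ℝ) 1))).map Prod.fst = volume.restrict (Icc 0 β) := by
    rw [Measure.map_fst_prod]; simp
  rw [hfst]
  rcases h1.lt_or_eq with h | rfl
  · have : (Prod.fst ∘ fun t : ℝ => (β + (1 - β) * t, t)) = fun t => β + (1 - β) * t := rfl
    rw [this, map_affine_volume_Icc h, ← Icc_union_Icc_eq_Icc h0.le h1,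
      Measure.restrict_congr_set (Ioc_ae_eq_Icc (μ := volume) (a := β) (b := 1)).symm,
      Measure.restrict_congr_set (show (Icc 0 β ∪ Icc β 1 : Set ℝ) =ᵐ[volume]
        (Icc 0 β ∪ Ioc β 1 : Set ℝ) from (ae_eq_refl _).union Ioc_ae_eq_Icc.symm),
      Measure.restrict_union _ measurableSet_Ioc]
    exact Set.disjoint_left.2 fun x hx hx' => not_lt.2 hx.2 hx'.1
  · simp

lemma map_snd_segmentLaw (β : ℝ) : (segmentLaw β).map Prod.snd = volume.restrict (Icc 0 1) := by
  rw [segmentLaw, Measure.map_map measurable_snd (measurable_segment β)]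
  exact Measure.map_id

lemma map_snd_bandPermuton (h0 : 0 < β) (h1 : β ≤ 1) :
    (bandPermuton β).map Prod.snd = volume.restrict (Icc 0 1) := by
  rw [bandPermuton, Measure.map_add _ _ measurable_snd, Measure.map_smul, map_snd_segmentLaw,
    volume_restrict_band, Measure.map_snd_prod, ← add_smul]
  simp only [Measure.restrict_apply_univ, Real.volume_Icc, sub_zero]
  rw [← ENNReal.ofReal_add h0.le (by linarith), add_sub_cancel, ENNReal.ofReal_one, one_smul]

lemma isPermuton_bandPermuton (h0 : 0 < β) (h1 : β ≤ 1) : IsPermuton (bandPermuton β) :=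
  ⟨map_fst_bandPermuton h0 h1, map_snd_bandPermuton h0 h1⟩

lemma isProbabilityMeasure_bandPermuton (h0 : 0 < β) (h1 : β ≤ 1) :
    IsProbabilityMeasure (bandPermuton β) := by
  constructor
  have := congrArg (fun ν : Measure ℝ => ν univ) (map_snd_bandPermuton h0 h1)
  simpa [Measure.map_apply measurable_snd] using this

/-- The segment meets the band only in the point `(β, 0)`, which has mass zero. -/
lemma restrict_band_bandPermuton (h1 : β ≤ 1) :
    (bandPermuton β).restrict (band β) = volume.restrict (band β) := by
  rw [bandPermuton, Measure.restrict_add, Measure.restrict_restrict (measurableSet_band β),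
    inter_self, Measure.restrict_smul]
  rcases h1.lt_or_eq with h | rfl
  · have : segmentLaw β (band β) = 0 := by
      rw [segmentLaw, Measure.map_apply (measurable_segment β) (measurableSet_band β)]
      refine measure_mono_null (t := {0}) (fun t ht => ?_) (by simp)
      have ht1 : β + (1 - β) * t ≤ β := ht.1.2
      have ht2 : 0 ≤ t := ht.2.1
      have : t ≤ 0 := by by_contra! h'; nlinarith
      exact le_antisymm this ht2
    rw [Measure.restrict_eq_zero.2 this]; simp
  · simp

/-- The horizontal strip of the points with `y ∈ (a, a']`. -/
def strip (a a' : ℝ) : Set (ℝ × ℝ) := {z | z.2 ∈ Ioc a a'}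

/-- The part of the strip `y ∈ (a, a']` on the line through `(β, 0)` and `(1, 1)`.
For `0 ≤ a` the half-open interval keeps the point `(β, 0)` of the band out. -/
def segmentStrip (β a a' : ℝ) : Set (ℝ × ℝ) := {z | z.2 ∈ Ioc a a' ∧ z.1 = β + (1 - β) * z.2}

lemma measurableSet_strip (a a' : ℝ) : MeasurableSet (strip a a') :=
  measurable_snd measurableSet_Ioc

lemma measurableSet_segmentStrip (β a a' : ℝ) : MeasurableSet (segmentStrip β a a') :=
  (measurable_snd measurableSet_Ioc).inter
    (measurableSet_eq_fun measurable_fst (by fun_prop))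

lemma segmentStrip_subset_strip (β a a' : ℝ) : segmentStrip β a a' ⊆ strip a a' :=
  fun _ hz => hz.1

lemma volume_Ioc_inter_Icc {a a' : ℝ} (ha : 0 ≤ a) (ha' : a' ≤ 1) :
    volume.restrict (Icc (0 : ℝ) 1) (Ioc a a') = ENNReal.ofReal (a' - a) := by
  rw [Measure.restrict_apply measurableSet_Ioc, inter_eq_left.2, Real.volume_Ioc]
  exact fun y hy => ⟨ha.trans hy.1.le, hy.2.trans ha'⟩

lemma bandPermuton_real_strip (h0 : 0 < β) (h1 : β ≤ 1) {a a' : ℝ} (ha : 0 ≤ a) (haa : a ≤ a')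
    (ha' : a' ≤ 1) : (bandPermuton β).real (strip a a') = a' - a := by
  rw [Measure.real, show strip a a' = Prod.snd ⁻¹' Ioc a a' from rfl,
    ← Measure.map_apply measurable_snd measurableSet_Ioc, map_snd_bandPermuton h0 h1,
    volume_Ioc_inter_Icc ha ha', ENNReal.toReal_ofReal (by linarith)]

lemma bandPermuton_real_segmentStrip (h1 : β < 1) {a a' : ℝ} (ha : 0 ≤ a)
    (haa : a ≤ a') (ha' : a' ≤ 1) :
    (bandPermuton β).real (segmentStrip β a a') = (1 - β) * (a' - a) := by
  have hm := measurableSet_segmentStrip β a a'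
  have hband : volume.restrict (band β) (segmentStrip β a a') = 0 := by
    rw [Measure.restrict_apply hm, show segmentStrip β a a' ∩ band β = ∅ from ?_, measure_empty]
    refine Set.eq_empty_of_forall_notMem fun z hz => ?_
    have hz1 : a < z.2 := hz.1.1.1
    have hz2 : z.1 = β + (1 - β) * z.2 := hz.1.2
    have hz3 : z.1 ≤ β := hz.2.1.2
    nlinarith
  have hseg : segmentLaw β (segmentStrip β a a') = ENNReal.ofReal (a' - a) := by
    rw [segmentLaw, Measure.map_apply (measurable_segment β) hm,
      show (fun t : ℝ => (β + (1 - β) * t, t)) ⁻¹' segmentStrip β a a' = Ioc a a' from ?_,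
      volume_Ioc_inter_Icc ha ha']
    ext t; simp [segmentStrip]
  rw [Measure.real, bandPermuton, Measure.add_apply, hband, zero_add, Measure.smul_apply, hseg,
    smul_eq_mul, ← ENNReal.ofReal_mul (by linarith), ENNReal.toReal_ofReal (by nlinarith)]

/-- A strip that contains exactly `k` points, all of them on the segment, contains a path with `k`
nodes of the tree. -/
lemma le_bstHeight_of_mem_cellCountEvent (h1 : β < 1) {n k : ℕ} {a a' : ℝ}
    {P : Fin n → ℝ × ℝ}
    (hP : P ∈ cellCountEvent (segmentStrip β a a') (strip a a') k) : k ≤ bstHeight P + 1 := by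
  simp only [cellCountEvent, mem_iUnion] at hP
  obtain ⟨s, hs, hP⟩ := hP
  rw [mem_cellEvent] at hP
  have hin : ∀ i, (P i).2 ∈ Ioc a a' → (P i).1 = β + (1 - β) * (P i).2 := fun i hi => by
    have := hP i
    split_ifs at this with h
    · exact this.2
    · exact (this hi).elim
  rw [← (Finset.mem_powersetCard.1 hs).2]
  refine card_le_bstHeight_add_one P (I := Ioc a a') ordConnected_Ioc (fun i j hi hj hij => ?_)
    fun i hi => ?_
  · rw [hin i hi, hin j hj] at hij
    by_contra! h
    nlinarith
  · have := hP i
    rw [if_pos hi] at this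
    exact this.1

end BandPermuton

/-! ### The height of the tree -/

lemma isProbabilityMeasure_sampleLaw (μ : Measure (ℝ × ℝ)) [IsProbabilityMeasure μ] (n : ℕ) :
    IsProbabilityMeasure (sampleLaw μ n) := by
  unfold sampleLaw; infer_instance

/-- Complement form of the lower bound: for `β < 1` the probability that the tree is lower than
`(1 - β) l log n` tends to zero, provided that `l < 1 / β`. -/
lemma tendsto_measureReal_bstHeight_lt {β l : ℝ} (h0 : 0 < β) (h1 : β < 1) (hl : 0 < l)
    (hβl : β * l < 1) :
    Tendsto (fun n : ℕ => (sampleLaw (bandPermuton β) n).real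
      {P | (bstHeight P : ℝ) < (1 - β) * l * Real.log n}) atTop (𝓝 0) := by
  have hprob := isProbabilityMeasure_bandPermuton h0 h1.le
  have hγ : 0 < 1 - β := by linarith
  refine squeeze_zero' (Eventually.of_forall fun n => measureReal_nonneg) ?_
    (tendsto_secondMomentBound hl hγ (by simpa using hβl))
  have hqlim : Tendsto (fun n : ℕ => l * Real.log n / n) atTop (𝓝 0) := by
    simpa [mul_div_assoc] using (tendsto_log_pow_div_natCast 1).const_mul l
  have hk : ∀ᶠ n : ℕ in atTop, 2 * (⌈(1 - β) * l * Real.log n⌉₊ + 1) ≤ n := by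
    have h := ((tendsto_log_pow_div_natCast 1).const_mul (2 * ((1 - β) * l))).add
      (tendsto_natCast_atTop_atTop.inv_tendsto_atTop.const_mul (4 : ℝ))
    rw [mul_zero, mul_zero, add_zero] at h
    filter_upwards [h.eventually_le_const (zero_lt_one), eventually_gt_atTop 0] with n h hn
    have hn0 : (0 : ℝ) < n := by exact_mod_cast hn
    have hlog : 0 ≤ Real.log n := Real.log_natCast_nonneg n
    have hc := (Nat.ceil_lt_add_one (by positivity : 0 ≤ (1 - β) * l * Real.log n)).le
    have h2 : 2 * ((1 - β) * l) * Real.log n + 4 ≤ n := by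
      have := mul_le_mul_of_nonneg_right h hn0.le
      simp only [Pi.inv_apply, pow_one] at this
      field_simp at this
      linarith
    have h3 : ((2 * (⌈(1 - β) * l * Real.log n⌉₊ + 1) : ℕ) : ℝ) ≤ n := by push_cast; linarith
    exact_mod_cast h3
  filter_upwards [hqlim.eventually_lt_const zero_lt_one, hk, eventually_gt_atTop 1]
    with n hq1 hk hn
  have := isProbabilityMeasure_sampleLaw (bandPermuton β) n
  have hlog : 0 < Real.log n := Real.log_pos (by exact_mod_cast hn)
  have hn0 : (0 : ℝ) < n := by exact_mod_cast (by omega : 0 < n)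
  set q := l * Real.log n / n with hq
  set k := ⌈(1 - β) * l * Real.log n⌉₊ + 1 with hkdef
  have hq0 : 0 < q := by positivity
  set m := ⌊q⁻¹⌋₊ with hm
  have hmq : m * q ≤ 1 := by
    calc m * q ≤ q⁻¹ * q := by gcongr; exact Nat.floor_le (by positivity)
      _ = 1 := inv_mul_cancel₀ hq0.ne'
  have htop : ∀ i : Fin m, (i + 1 : ℝ) * q ≤ 1 := fun i => by
    refine le_trans ?_ hmq
    gcongr
    exact_mod_cast i.2
  have hdiff : ∀ i : Fin m, (i + 1 : ℝ) * q - i * q = q := fun i => by ring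
  have hmain := measureReal_compl_iUnion_cellCountEvent_le (n := n) (bandPermuton β) (m := m)
    (fun i => segmentStrip β (i * q) ((i + 1) * q)) (fun i => strip (i * q) ((i + 1) * q))
    (fun i => measurableSet_segmentStrip _ _ _) (fun i => measurableSet_strip _ _)
    (fun i => segmentStrip_subset_strip _ _ _) (b := (1 - β) * q) (q := q)
    (fun i j hij => ?_)
    (fun i => by
      rw [bandPermuton_real_segmentStrip h1 (by positivity) (by nlinarith) (htop i), hdiff])
    (fun i => by
      rw [bandPermuton_real_strip h0 h1.le (by positivity) (by nlinarith) (htop i), hdiff])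
    (by positivity) hq1 (Nat.floor_pos.2 ((one_le_inv₀ hq0).2 hq1.le)) hk
  · refine le_trans (measureReal_mono (fun P hP => ?_) (measure_ne_top _ _)) hmain
    simp only [mem_compl_iff, mem_iUnion, not_exists]
    intro i hi
    have hh := le_bstHeight_of_mem_cellCountEvent h1 hi
    have hh' : ⌈(1 - β) * l * Real.log n⌉₊ ≤ bstHeight P := by omega
    exact absurd (Nat.ceil_le.1 hh') (not_le.2 hP)
  · refine Set.disjoint_left.2 fun z hz hz' => hij ?_
    have key : ∀ i j : Fin m, z.2 ∈ Ioc ((i : ℝ) * q) ((i + 1) * q) →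
        z.2 ∈ Ioc ((j : ℝ) * q) ((j + 1) * q) → (i : ℕ) ≤ j := fun i j hi hj => by
      have h := lt_of_mul_lt_mul_right (hi.1.trans_le hj.2) hq0.le
      have h' : (i : ℕ) < j + 1 := by exact_mod_cast h
      omega
    exact Fin.ext (le_antisymm (key i j hz hz') (key j i hz' hz))

/-- With probability tending to one the tree has height at least `(1 - β) / (β + ε) * log n`: for
`l = 1 / (β + ε)`, the exponent `1 - β l` of the expected number of good
strips is positive. -/
lemma tendsto_sampleLaw_le_bstHeight {β ε : ℝ} (h0 : 0 < β) (h1 : β ≤ 1) (hε : 0 < ε) :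
    Tendsto (fun n : ℕ => sampleLaw (bandPermuton β) n
      {P | (1 - β) / (β + ε) * Real.log (n : ℝ) ≤ (bstHeight P : ℝ)}) atTop (𝓝 1) := by
  have hprob := isProbabilityMeasure_bandPermuton h0 h1
  have hprobn := isProbabilityMeasure_sampleLaw (bandPermuton β)
  rcases h1.lt_or_eq with h1 | rfl
  · have hlt := tendsto_measureReal_bstHeight_lt (l := 1 / (β + ε)) h0 h1 (by positivity)
      (by rw [mul_one_div, div_lt_one (by positivity)]; linarith)
    have hlow := ENNReal.Tendsto.sub (tendsto_const_nhds (x := (1 : ENNReal)))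
      (ENNReal.tendsto_ofReal hlt) (Or.inl ENNReal.one_ne_top)
    rw [ENNReal.ofReal_zero, tsub_zero] at hlow
    refine tendsto_of_tendsto_of_tendsto_of_le_of_le hlow tendsto_const_nhds (fun n => ?_)
      fun n => prob_le_one
    rw [ofReal_measureReal (measure_ne_top _ _)]
    simp only [mul_one_div]
    rw [tsub_le_iff_left, ← measure_univ (μ := sampleLaw (bandPermuton β) n)]
    refine (measure_mono fun P _ => ?_).trans (measure_union_le _ _)
    exact lt_or_ge (bstHeight P : ℝ) ((1 - β) / (β + ε) * Real.log n)
  · -- For `β = 1` there is no segment, and the lower bound is zero.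
    simp

lemma two_le_cStar : 2 ≤ cStar := existsUnique_cStar.choose_spec.1.1

theorem proposition5p2 :
    (∀ β : ℝ, 0 < β → β ≤ 1 →
      IsPermuton (bandPermuton β) ∧
      (bandPermuton β).restrict (band β) = volume.restrict (band β) ∧
      ∀ ε : ℝ, 0 < ε →
        Tendsto
          (fun n : ℕ => sampleLaw (bandPermuton β) n
            {P | (1 - β) / (β + ε) * Real.log (n : ℝ) ≤ (bstHeight P : ℝ)})
          atTop (𝓝 1)) ∧
    (∀ β : ℝ, 0 < β → β < 1 / (1 + cStar) →
      ¬ SampleTendstoInProbability (bandPermuton β)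
          (fun n P => (bstHeight P : ℝ) / (cStar * Real.log (n : ℝ))) 1) := by
  refine ⟨fun β h0 h1 => ⟨isPermuton_bandPermuton h0 h1, restrict_band_bandPermuton h1,
    fun ε hε => tendsto_sampleLaw_le_bstHeight h0 h1 hε⟩, fun β h0 hβ hconv => ?_⟩
  have hc := two_le_cStar
  have hc0 : 0 < cStar := by linarith
  rw [lt_div_iff₀ (by linarith)] at hβ
  have h1 : β ≤ 1 := by nlinarith
  -- For this `ε`, `c * (β + ε)` is the mean of `c * β` and `1 - β`.
  set ε : ℝ := (1 - β - cStar * β) / (2 * cStar) with hεdef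
  have hε : 0 < ε := div_pos (by linarith) (by linarith)
  have hcε : cStar * ε = (1 - β - cStar * β) / 2 := by rw [hεdef]; field_simp
  set κ : ℝ := (1 - β) / (β + ε) with hκdef
  have hκ : cStar < κ := by
    rw [hκdef, lt_div_iff₀ (by linarith)]
    linarith
  have hδ : 0 < κ / cStar - 1 := sub_pos.2 ((one_lt_div hc0).2 hκ)
  refine absurd (le_of_tendsto_of_tendsto (tendsto_sampleLaw_le_bstHeight h0 h1 hε)
    (hconv _ hδ) ?_) (by simp)
  filter_upwards [eventually_gt_atTop 1] with n hn
  have hlog : 0 < Real.log n := Real.log_pos (by exact_mod_cast hn)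
  refine measure_mono fun P hP => ?_
  have hP : κ * Real.log n ≤ (bstHeight P : ℝ) := hP
  refine le_trans (sub_le_sub_right (?_ : κ / cStar ≤ _) (1 : ℝ)) (le_abs_self _)
  rw [div_le_div_iff₀ hc0 (by positivity)]
  nlinarith
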